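/- Let $p:\mathbb N\to[0,1]$, and for each $n$ let $G=G(n,p)$ be the Erdős–Rényi random graph on $n$ vertices in which every pair of vertices is an edge independently with probability $p=p(n)$. For a graph $G$ on $n$ vertices let $W$ be its adjacency matrix, $m$ its number of edges, $\lambda_n$ the smallest eigenvalue of $W$, $\chi(G)=-n\lambda_n$, and $mc(G)$ the number of edges of a maximum cut. For a finite set $\mathcal S\subseteq\mathbb R^n$ consider the linear program $$(SP_{\mathcal S})\qquad \max_X\ \tfrac12 m+\tfrac14\langle -W,X\rangle\quad\text{s.t. } X=X^\top,\ v^\top Xv\ge 0\ \ \forall v\in\mathcal S,\ \ X_{ii}=1\ \ \forall i,\ \ |X_{ij}|\le 1\ \ \forall i,j .$$ Put $Q(G)=\dfrac{\frac12 m+\frac14\chi(G)}{\frac12 m}$. Say that $Q(G)$ is certified if $m>0$, for every orthonormal basis $\mathcal S$ of $\mathbb R^n$ consisting of eigenvectors of $W$ the program $(SP_{\mathcal S})$ attains its maximum $z$ and $mc(G)\le z\le \frac12 m+\frac14\chi(G)$, and consequently $\dfrac{mc(G)}{\frac12 m}\le Q(G)$. "With high probability" means with probability tending to $1$ as $n\to\infty$,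 and $\log$ is the natural logarithm. Then: (1) Let $g:\mathbb N\to\mathbb R$ be non-decreasing and eventually positive, and suppose that $np(n)\ge\frac{g(n)}{2}\log n$ for all sufficiently large $n$. Then, with high probability, $Q(G)$ is certified and $Q(G)\le 1+\sqrt{2/g(n)}$. (2) (Dense graphs.) Suppose that $p(n)=\Omega\big(\sqrt{\log(n)/n}\big)$. Then there is a non-decreasing $g$ with $np(n)\ge g(n)\ge\sqrt n$ for all sufficiently large $n$, and $Q(G)$ converges to $1$ in probability: for every $\varepsilon>0$, with high probability $Q(G)$ is certified and $|Q(G)-1|\le\varepsilon$. (3) (Sparse graphs.) Let $c>0$ be a constant and suppose that $np(n)=c\log n$ for all sufficiently large $n$. Then, with high probability, $Q(G)$ is certified and $Q(G)\le 1+\sqrt{2/c}$. -/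

import Mathlib

namespace MaxCutSpectral

open Matrix
open scoped SimpleGraph

noncomputable section

variable {n : ℕ}

/-- The number `m` of edges of `G`. -/
def numEdges (G : SimpleGraph (Fin n)) : ℕ := G.edgeSet.ncard

open Classical in
/-- The real adjacency matrix `W` of `G`. -/
def adj (G : SimpleGraph (Fin n)) : Matrix (Fin n) (Fin n) ℝ := G.adjMatrix ℝ

theorem adj_isHermitian (G : SimpleGraph (Fin n)) : (adj G).IsHermitian := by
  classical
  exact G.isHermitian_adjMatrix ℝ

open Classical in
/-- The value `mc(G)` of a maximum cut: the largest number of edges with one end in a vertex set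
`S` and the other end outside it (`G.interedges S Sᶜ` lists each such edge once, from `S`
to its complement). -/
def maxCut (G : SimpleGraph (Fin n)) : ℕ :=
  (Finset.univ : Finset (Finset (Fin n))).sup fun S => (G.interedges S Sᶜ).card

/-- The smallest eigenvalue `λ_n` of the adjacency matrix. -/
def minEigenvalue (G : SimpleGraph (Fin n)) : ℝ := ⨅ i, (adj_isHermitian G).eigenvalues i

/-- `χ(G) = -n λ_n`. -/
def chi (G : SimpleGraph (Fin n)) : ℝ := -((n : ℝ) * minEigenvalue G)

/-- The eigenvalue bound `m / 2 + χ(G) / 4` for the maximum cut. -/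
def eigenvalueBound (G : SimpleGraph (Fin n)) : ℝ :=
  (1 / 2 : ℝ) * numEdges G + (1 / 4 : ℝ) * chi G

/-- The eigenvalue bound divided by `m / 2`; meaningful when `G` has an edge. -/
def quotient (G : SimpleGraph (Fin n)) : ℝ :=
  eigenvalueBound G / ((1 / 2 : ℝ) * numEdges G)

/-- The feasible set of the linear program `SP_S`: symmetric matrices with unit diagonal, entries
of absolute value at most one, and `vᵀ X v ≥ 0` for every `v ∈ S`. -/
def lpFeasible (S : Set (Fin n → ℝ)) : Set (Matrix (Fin n) (Fin n) ℝ) :=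
  {X | X.IsSymm ∧ (∀ v ∈ S, 0 ≤ v ⬝ᵥ (X *ᵥ v)) ∧ (∀ i, X i i = 1) ∧ ∀ i j, |X i j| ≤ 1}

/-- The objective `m / 2 + ⟨-W, X⟩ / 4` of `SP_S`. -/
def lpObjective (G : SimpleGraph (Fin n)) (X : Matrix (Fin n) (Fin n) ℝ) : ℝ :=
  (1 / 2 : ℝ) * numEdges G + (1 / 4 : ℝ) * ((-(adj G))ᵀ * X).trace

/-- `z` is the optimal (maximum, attained) value of the linear program `SP_S`, including the
additive constant `m / 2` and the factor `1 / 4`. -/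
def IsLPOptimum (G : SimpleGraph (Fin n)) (S : Set (Fin n → ℝ)) (z : ℝ) : Prop :=
  IsGreatest (lpObjective G '' lpFeasible S) z

/-- `S` is the set of vectors of an orthonormal basis of `ℝⁿ` that consists of eigenvectors
of the adjacency matrix. -/
def IsEigenbasis (G : SimpleGraph (Fin n)) (S : Set (Fin n → ℝ)) : Prop :=
  ∃ b : OrthonormalBasis (Fin n) ℝ (EuclideanSpace ℝ (Fin n)),
    (∀ i, ∃ μ : ℝ, adj G *ᵥ (b i).ofLp = μ • (b i).ofLp) ∧ S = Set.range fun i => (b i).ofLp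

/-- The quotient is a certified upper bound for `mc(G) / (m / 2)`: there is an edge, and for every
orthonormal eigenbasis `S` of the adjacency matrix the optimal value of `SP_S` lies between
the maximum cut and the eigenvalue bound. -/
def Certifies (G : SimpleGraph (Fin n)) : Prop :=
  0 < numEdges G ∧
  (∀ S, IsEigenbasis G S →
    ∃ z, IsLPOptimum G S z ∧ (maxCut G : ℝ) ≤ z ∧ z ≤ eigenvalueBound G) ∧
  (maxCut G : ℝ) / ((1 / 2 : ℝ) * numEdges G) ≤ quotient G

/-- `E n` holds with high probability for the Erdős–Rényi graph `G(n, p(n))`: its probability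
tends to one as `n → ∞`. -/
def WHP (p : ℕ → unitInterval) (E : ∀ n : ℕ, SimpleGraph (Fin n) → Prop) : Prop :=
  Filter.Tendsto (fun n : ℕ => SimpleGraph.binomialRandom (Fin n) (p n) {G | E n G})
    Filter.atTop (nhds 1)

end

end MaxCutSpectral

namespace MaxCutSpectral

open Matrix
open scoped SimpleGraph

/-! ### Trace inequalities for rank-one updates of positive semidefinite matrices. -/

section LinearAlgebra

variable {n : ℕ}

/-! The certificate is deterministic. A cut gives a feasible matrix `s sᵀ` whose objective is the
cut size, and any feasible `X` has `tr (X W) = ∑ tᵢ vᵢᵀ X vᵢ ≥ λ_n tr X = n λ_n`; compactness gives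
attainment. So every graph with an edge is certified. Since `Q = 1 + χ / (2m)`, what remains is to
bound `-λ_n` above and `m` below.

For the eigenvalue, write `W = U + Uᵀ + p (J - I)` with `U` the strictly upper triangular part of
the centred matrix. As `p J` is positive semidefinite, `-λ_n ≤ 2 ‖U‖ + p`, and `Uᵀ U` is the sum of
`c cᵀ` over the rows `c` of `U`, which are independent. Its trace moments are bounded by adding one
row at a time (`trace_rankOne_update_le`, `integral_trace_gram_pow_le`), after discarding rows of
squared length above `R`; a Chernoff bound shows that typically none is discarded
(`measureReal_row_large_le`). Markov's inequality with an exponent of order `log n` gives `-λ_n ≤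
√(np log n) / 4`, while `m` is at least half its mean, both with high probability once `np ≥ c log
n`. Hence `Q ≤ 1 + √(log n / (np))` (`whp_certifies_and_quotient_le`), from which all three cases
follow. -/

theorem sum_basis_mul_basis (b : OrthonormalBasis (Fin n) ℝ (EuclideanSpace ℝ (Fin n)))
    (k l : Fin n) : ∑ i, b i k * b i l = if k = l then 1 else 0 := by
  have h := b.sum_inner_mul_inner (EuclideanSpace.single k (1 : ℝ)) (EuclideanSpace.single l 1)
  simpa [EuclideanSpace.inner_single_left, EuclideanSpace.inner_single_right,
    Pi.single_apply, eq_comm] using h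

theorem trace_eq_sum_quadForm (b : OrthonormalBasis (Fin n) ℝ (EuclideanSpace ℝ (Fin n)))
    (X : Matrix (Fin n) (Fin n) ℝ) :
    X.trace = ∑ i, (b i).ofLp ⬝ᵥ (X *ᵥ (b i).ofLp) := by
  simp only [dotProduct, mulVec, Finset.mul_sum, Matrix.trace, diag_apply]
  rw [Finset.sum_comm]
  refine Finset.sum_congr rfl fun k _ => ?_
  rw [Finset.sum_comm]
  have h : ∀ l, ∑ i, b i k * (X k l * b i l) = X k l * if k = l then 1 else 0 := fun l => by
    rw [← sum_basis_mul_basis b, Finset.mul_sum]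
    exact Finset.sum_congr rfl fun i _ => by ring
  simp [h]

theorem trace_vecMulVec_mul (c d : Fin n → ℝ) (P : Matrix (Fin n) (Fin n) ℝ) :
    (vecMulVec c d * P).trace = d ⬝ᵥ (P *ᵥ c) := by
  rw [Matrix.trace_mul_comm, mul_vecMulVec, trace_vecMulVec, dotProduct_comm]

theorem basis_dotProduct (b : OrthonormalBasis (Fin n) ℝ (EuclideanSpace ℝ (Fin n)))
    (i j : Fin n) : (b i).ofLp ⬝ᵥ (b j).ofLp = if i = j then 1 else 0 := by
  have h := orthonormal_iff_ite.1 b.orthonormal j i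
  simpa [EuclideanSpace.inner_eq_star_dotProduct, eq_comm] using h

/-- Evaluate the trace of `c cᵀ P` in the basis `b`. Only the action of `P` on `b` matters, so one
eigenbasis of `A` serves every polynomial in `A`. -/
theorem quadForm_eq_sum (b : OrthonormalBasis (Fin n) ℝ (EuclideanSpace ℝ (Fin n)))
    {P : Matrix (Fin n) (Fin n) ℝ} {f : Fin n → ℝ}
    (hP : ∀ i, P *ᵥ (b i).ofLp = f i • (b i).ofLp) (c : Fin n → ℝ) :
    c ⬝ᵥ (P *ᵥ c) = ∑ i, f i * ((b i).ofLp ⬝ᵥ c) ^ 2 := by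
  rw [← trace_vecMulVec_mul, trace_eq_sum_quadForm b]
  refine Finset.sum_congr rfl fun i _ => ?_
  rw [← mulVec_mulVec, hP, mulVec_smul, vecMulVec_mulVec]
  simp only [dotProduct_smul, MulOpposite.smul_eq_mul_unop, smul_eq_mul, MulOpposite.unop_op,
    dotProduct_comm c]
  ring

theorem trace_eq_sum_of_eigen (b : OrthonormalBasis (Fin n) ℝ (EuclideanSpace ℝ (Fin n)))
    {P : Matrix (Fin n) (Fin n) ℝ} {f : Fin n → ℝ}
    (hP : ∀ i, P *ᵥ (b i).ofLp = f i • (b i).ofLp) : P.trace = ∑ i, f i := by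
  rw [trace_eq_sum_quadForm b]
  simp [hP, basis_dotProduct]

theorem dotProduct_self_eq_sum (b : OrthonormalBasis (Fin n) ℝ (EuclideanSpace ℝ (Fin n)))
    (c : Fin n → ℝ) : c ⬝ᵥ c = ∑ i, ((b i).ofLp ⬝ᵥ c) ^ 2 := by
  simpa using quadForm_eq_sum b (P := 1) (f := fun _ => 1) (by simp) c

theorem pow_mulVec_eigen {A : Matrix (Fin n) (Fin n) ℝ} {v : Fin n → ℝ} {t : ℝ}
    (h : A *ᵥ v = t • v) (j : ℕ) : (A ^ j) *ᵥ v = t ^ j • v := by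
  induction j with
  | zero => simp
  | succ j ih => rw [pow_succ, ← mulVec_mulVec, h, mulVec_smul, ih, smul_smul, pow_succ']

theorem pow_mul_pow_mulVec_eigen {A : Matrix (Fin n) (Fin n) ℝ} {v : Fin n → ℝ} {t : ℝ}
    (h : A *ᵥ v = t • v) (R : ℝ) (j i : ℕ) :
    (A ^ j * (A + R • 1) ^ i) *ᵥ v = (t ^ j * (t + R) ^ i) • v := by
  have h2 : (A + R • 1) *ᵥ v = (t + R) • v := by
    rw [add_mulVec, h, smul_mulVec, one_mulVec, add_smul]
  rw [← mulVec_mulVec, pow_mulVec_eigen h2, mulVec_smul, pow_mulVec_eigen h, smul_smul, mul_comm]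

/-- Chebyshev's inequality for weighted sums. -/
theorem sum_mul_sum_le_of_monovary {ι : Type*} (s : Finset ι) (w f g : ι → ℝ)
    (hw : ∀ i, 0 ≤ w i) (hfg : ∀ i j, 0 ≤ (f i - f j) * (g i - g j)) :
    (∑ i ∈ s, f i * w i) * ∑ i ∈ s, g i * w i ≤ (∑ i ∈ s, w i) * ∑ i ∈ s, f i * g i * w i := by
  have h : 0 ≤ ∑ i ∈ s, ∑ j ∈ s, w i * w j * ((f i - f j) * (g i - g j)) :=
    Finset.sum_nonneg fun i _ => Finset.sum_nonneg fun j _ =>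
      mul_nonneg (mul_nonneg (hw i) (hw j)) (hfg i j)
  have e : ∑ i ∈ s, ∑ j ∈ s, w i * w j * ((f i - f j) * (g i - g j)) =
      (∑ i ∈ s, f i * g i * w i) * (∑ j ∈ s, w j) + (∑ i ∈ s, w i) * (∑ j ∈ s, f j * g j * w j)
      - (∑ i ∈ s, f i * w i) * (∑ j ∈ s, g j * w j)
      - (∑ i ∈ s, g i * w i) * (∑ j ∈ s, f j * w j) := by
    simp only [Finset.sum_mul_sum, ← Finset.sum_add_distrib, ← Finset.sum_sub_distrib]
    exact Finset.sum_congr rfl fun i _ => Finset.sum_congr rfl fun j _ => by ring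
  rw [e] at h
  nlinarith [h]

theorem eigenvectorBasis_mulVec {A : Matrix (Fin n) (Fin n) ℝ} (hA : A.IsHermitian) (i : Fin n) :
    A *ᵥ (hA.eigenvectorBasis i).ofLp = hA.eigenvalues i • (hA.eigenvectorBasis i).ofLp := by
  simpa using hA.mulVec_eigenvectorBasis i

/-- Chebyshev's inequality for the spectral measure of `c`, whose total mass is `c ⬝ᵥ c ≤ R`: both
`t ^ j` and `(t + R) ^ i` increase on the spectrum. -/
theorem quadForm_pow_mul_le {A : Matrix (Fin n) (Fin n) ℝ} (hA : A.PosSemidef) {c : Fin n → ℝ}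
    {R : ℝ} (hR : c ⬝ᵥ c ≤ R) (j i : ℕ) :
    (c ⬝ᵥ (A ^ j *ᵥ c)) * (c ⬝ᵥ ((A + R • 1) ^ i *ᵥ c)) ≤
      R * (c ⬝ᵥ ((A ^ j * (A + R • 1) ^ i) *ᵥ c)) := by
  have hR0 : 0 ≤ R := (dotProduct_self_star_nonneg c).trans (by simpa using hR)
  set b := hA.1.eigenvectorBasis
  set t := hA.1.eigenvalues
  have ht : ∀ l, 0 ≤ t l := hA.eigenvalues_nonneg
  have hb : ∀ l, A *ᵥ (b l).ofLp = t l • (b l).ofLp := eigenvectorBasis_mulVec hA.1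
  have key : ∀ j i, c ⬝ᵥ ((A ^ j * (A + R • 1) ^ i) *ᵥ c) =
      ∑ l, (t l ^ j * (t l + R) ^ i) * ((b l).ofLp ⬝ᵥ c) ^ 2 := fun j i =>
    quadForm_eq_sum b (fun l => pow_mul_pow_mulVec_eigen (hb l) R j i) c
  have k1 := key j 0
  have k2 := key 0 i
  simp only [pow_zero, mul_one, one_mul] at k1 k2
  rw [k1, k2, key]
  refine (sum_mul_sum_le_of_monovary _ _ _ _ (fun _ => sq_nonneg _) fun k l => ?_).trans ?_
  · rcases le_total (t k) (t l) with h | h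
    · exact mul_nonneg_of_nonpos_of_nonpos (sub_nonpos.2 (pow_le_pow_left₀ (ht k) h _))
        (sub_nonpos.2 (pow_le_pow_left₀ (add_nonneg (ht k) hR0) (by linarith) _))
    · exact mul_nonneg (sub_nonneg.2 (pow_le_pow_left₀ (ht l) h _))
        (sub_nonneg.2 (pow_le_pow_left₀ (add_nonneg (ht l) hR0) (by linarith) _))
  · rw [← dotProduct_self_eq_sum]
    refine mul_le_mul_of_nonneg_right hR (Finset.sum_nonneg fun l _ => ?_)
    have := ht l
    positivity

theorem posSemidef_pow_mul_pow {A : Matrix (Fin n) (Fin n) ℝ} (hA : A.PosSemidef) {R : ℝ}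
    (hR : 0 ≤ R) (j i : ℕ) : (A ^ j * (A + R • 1) ^ i).PosSemidef := by
  have hc : Commute A (A + R • 1) := (Commute.refl A).add_right ((Commute.one_right A).smul_right R)
  have hB : (A + R • (1 : Matrix (Fin n) (Fin n) ℝ)).IsHermitian := by
    refine hA.1.add ?_
    simp [IsHermitian]
  refine PosSemidef.of_dotProduct_mulVec_nonneg ?_ fun x => ?_
  · exact ((hA.1.pow j).commute_iff (hB.pow i)).1 (hc.pow_pow j i)
  · have := quadForm_eq_sum hA.1.eigenvectorBasis
      (fun l => pow_mul_pow_mulVec_eigen (eigenvectorBasis_mulVec hA.1 l) R j i) x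
    simp only [star_trivial]
    rw [this]
    refine Finset.sum_nonneg fun l _ => ?_
    have := hA.eigenvalues_nonneg l
    positivity

/-- Inside a quadratic form at `c`, the update `c cᵀ` may be replaced by `R • 1`, which commutes
with `A`. Peeling off one factor, the `c cᵀ` term splits into a product of two quadratic forms,
which `quadForm_pow_mul_le` recombines. -/
theorem quadForm_rankOne_update_le {A : Matrix (Fin n) (Fin n) ℝ} (hA : A.PosSemidef)
    {c : Fin n → ℝ} {R : ℝ} (hR : c ⬝ᵥ c ≤ R) (i : ℕ) : ∀ j : ℕ,
    c ⬝ᵥ ((A ^ j * (A + vecMulVec c c) ^ i) *ᵥ c) ≤ c ⬝ᵥ ((A ^ j * (A + R • 1) ^ i) *ᵥ c) := by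
  have hm : ∀ j, 0 ≤ c ⬝ᵥ (A ^ j *ᵥ c) := fun j => by
    simpa using (hA.pow j).dotProduct_mulVec_nonneg c
  induction i with
  | zero => intro j; simp
  | succ i ih =>
    intro j
    have e : A ^ j * (A + vecMulVec c c) ^ (i + 1) = A ^ (j + 1) * (A + vecMulVec c c) ^ i +
        A ^ j * vecMulVec c c * (A + vecMulVec c c) ^ i := by
      rw [pow_succ' (A + _), pow_succ A]; noncomm_ring
    have e' : A ^ j * (A + R • 1) ^ (i + 1) = A ^ (j + 1) * (A + R • 1) ^ i +
        R • (A ^ j * (A + R • 1) ^ i) := by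
      rw [pow_succ' (A + _), pow_succ A, add_mul, mul_add]
      simp [mul_assoc]
    have f : c ⬝ᵥ ((A ^ j * vecMulVec c c * (A + vecMulVec c c) ^ i) *ᵥ c) =
        (c ⬝ᵥ (A ^ j *ᵥ c)) * (c ⬝ᵥ ((A + vecMulVec c c) ^ i *ᵥ c)) := by
      rw [mul_assoc, ← mulVec_mulVec, ← mulVec_mulVec, vecMulVec_mulVec, mulVec_smul,
        dotProduct_smul]
      simp
    have i0 := ih 0
    rw [pow_zero, one_mul, one_mul] at i0
    rw [e, e', add_mulVec, add_mulVec, dotProduct_add, dotProduct_add, f, smul_mulVec,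
      dotProduct_smul, smul_eq_mul]
    exact add_le_add (ih _) ((mul_le_mul_of_nonneg_left i0 (hm j)).trans
      (quadForm_pow_mul_le hA hR j i))

theorem isHermitian_vecMulVec_self (c : Fin n → ℝ) : (vecMulVec c c).IsHermitian := by
  ext i j; simp [vecMulVec_apply, mul_comm]

theorem posSemidef_vecMulVec (c : Fin n → ℝ) : (vecMulVec c c).PosSemidef := by
  simpa using Matrix.posSemidef_vecMulVec_self_star c

/-- Turn the factors `B` into `A` one at a time; each replacement costs a quadratic form at `c`. The
resulting matrix depends on `A` and `R` but no longer on `c`, so a random `c` independent of `A` can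
be averaged out. -/
theorem trace_rankOne_update_le {A : Matrix (Fin n) (Fin n) ℝ} (hA : A.PosSemidef)
    {c : Fin n → ℝ} {R : ℝ} (hR : c ⬝ᵥ c ≤ R) (q : ℕ) :
    ((A + vecMulVec c c) ^ q).trace ≤ (A ^ q).trace +
      c ⬝ᵥ ((∑ i ∈ Finset.range q, A ^ (q - 1 - i) * (A + R • 1) ^ i) *ᵥ c) := by
  set B := A + vecMulVec c c with hB
  have hBh : B.IsHermitian := hA.1.add (isHermitian_vecMulVec_self c)
  have key : ∀ i, ∀ j, (A ^ j * B ^ i).trace ≤ (A ^ (j + i)).trace +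
      ∑ l ∈ Finset.range i, c ⬝ᵥ ((A ^ (j + i - 1 - l) * (A + R • 1) ^ l) *ᵥ c) := by
    intro i
    induction i with
    | zero => intro j; simp
    | succ i ih =>
      intro j
      have e : A ^ j * B ^ (i + 1) = A ^ (j + 1) * B ^ i + A ^ j * (vecMulVec c c * B ^ i) := by
        rw [pow_succ' B, pow_succ A]; nth_rewrite 1 [hB]; noncomm_ring
      have f : (A ^ j * (vecMulVec c c * B ^ i)).trace = c ⬝ᵥ ((A ^ j * B ^ i) *ᵥ c) := by
        rw [Matrix.trace_mul_comm, mul_assoc, trace_vecMulVec_mul, dotProduct_mulVec,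
          ← mulVec_transpose, dotProduct_comm, transpose_mul]
        have h1 : (A ^ j)ᵀ = A ^ j := by simpa using (hA.1.pow j).eq
        have h2 : (B ^ i)ᵀ = B ^ i := by simpa using (hBh.pow i).eq
        rw [h1, h2]
      rw [e, trace_add, f, Finset.sum_range_succ, ← add_assoc]
      have := ih (j + 1)
      rw [show j + 1 + i = j + (i + 1) by ring] at this
      refine add_le_add this ?_
      rw [show j + (i + 1) - 1 - i = j by omega]
      exact quadForm_rankOne_update_le hA hR i j
  have := key q 0
  simpa [sum_mulVec, dotProduct_sum] using this

/-- The geometric sum telescopes to `(A + R • 1) ^ q - A ^ q`; the binomial expansion then leaves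
only lower moments of `A`. -/
theorem trace_sum_pow_mul_pow (A : Matrix (Fin n) (Fin n) ℝ) (R : ℝ) (q : ℕ) :
    R * (∑ i ∈ Finset.range q, A ^ (q - 1 - i) * (A + R • 1) ^ i).trace =
      ∑ r ∈ Finset.range q, q.choose (r + 1) * R ^ (r + 1) * (A ^ (q - (r + 1))).trace := by
  have hc : Commute (A + R • 1) A :=
    ((Commute.refl A).add_right ((Commute.one_right A).smul_right R)).symm
  have h := hc.geom_sum₂_mul q
  have h1 : (∑ i ∈ Finset.range q, (A + R • 1) ^ i * A ^ (q - 1 - i)) =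
      ∑ i ∈ Finset.range q, A ^ (q - 1 - i) * (A + R • 1) ^ i :=
    Finset.sum_congr rfl fun i _ => (hc.pow_pow _ _).eq
  rw [h1, add_sub_cancel_left, mul_smul_comm, mul_one] at h
  have h2 := congrArg Matrix.trace h
  rw [trace_smul, smul_eq_mul] at h2
  rw [h2]
  have hc2 : Commute (R • (1 : Matrix (Fin n) (Fin n) ℝ)) A := (Commute.one_left A).smul_left R
  rw [add_comm A, hc2.add_pow, Finset.sum_range_succ']
  simp only [smul_pow, one_pow, trace_sub, trace_add, trace_sum]
  simp only [pow_zero, one_smul, one_mul, Nat.choose_zero_right, Nat.cast_one, mul_one,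
    tsub_zero, add_sub_cancel_right]
  refine Finset.sum_congr rfl fun r _ => ?_
  rw [smul_mul_assoc, one_mul, smul_mul_assoc, trace_smul, ← nsmul_eq_mul', trace_smul]
  simp
  ring

/-- Jensen's inequality with the weights `(b l ⬝ᵥ x) ^ 2`, which sum to one and so are each at most
one. -/
theorem quadForm_pow_le_trace_pow {A : Matrix (Fin n) (Fin n) ℝ} (hA : A.PosSemidef)
    {x : Fin n → ℝ} (hx : x ⬝ᵥ x = 1) (q : ℕ) : (x ⬝ᵥ (A *ᵥ x)) ^ q ≤ (A ^ q).trace := by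
  set b := hA.1.eigenvectorBasis
  set t := hA.1.eigenvalues
  have ht : ∀ l, 0 ≤ t l := hA.eigenvalues_nonneg
  have hb : ∀ l, A *ᵥ (b l).ofLp = t l • (b l).ofLp := eigenvectorBasis_mulVec hA.1
  rw [quadForm_eq_sum b hb, trace_eq_sum_of_eigen b (fun l => pow_mulVec_eigen (hb l) q)]
  rw [dotProduct_self_eq_sum b] at hx
  have h := Real.pow_arith_mean_le_arith_mean_pow Finset.univ
    (fun l => ((b l).ofLp ⬝ᵥ x) ^ 2) t (fun _ _ => sq_nonneg _) hx (fun l _ => ht l) q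
  simp only [mul_comm (t _)]
  refine h.trans (Finset.sum_le_sum fun l _ => ?_)
  refine mul_le_of_le_one_left (pow_nonneg (ht l) _) ?_
  rw [← hx]
  exact Finset.single_le_sum (f := fun l => ((b l).ofLp ⬝ᵥ x) ^ 2) (fun _ _ => sq_nonneg _)
    (Finset.mem_univ l)

end LinearAlgebra

/-! ### Trace moments of a sum of independent rank-one matrices. -/

section MomentBound

open MeasureTheory ProbabilityTheory
open scoped Nat

variable {n : ℕ} {ι Ω : Type*} [MeasurableSpace Ω] {μ : Measure Ω}

/-- The Gram matrix `∑ k ∈ s, c_k c_kᵀ` of a family of vectors. -/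
def gram (c : ι → Fin n → ℝ) (s : Finset ι) : Matrix (Fin n) (Fin n) ℝ :=
  ∑ k ∈ s, vecMulVec (c k) (c k)

theorem posSemidef_gram (c : ι → Fin n → ℝ) (s : Finset ι) : (gram c s).PosSemidef :=
  posSemidef_sum s fun k _ => posSemidef_vecMulVec (c k)

theorem gram_insert [DecidableEq ι] (c : ι → Fin n → ℝ) {s : Finset ι} {a : ι} (ha : a ∉ s) :
    gram c (insert a s) = gram c s + vecMulVec (c a) (c a) := by
  rw [gram, Finset.sum_insert ha, add_comm, gram]

theorem dotProduct_gram_mulVec (c : ι → Fin n → ℝ) (s : Finset ι) (x : Fin n → ℝ) :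
    x ⬝ᵥ (gram c s *ᵥ x) = ∑ k ∈ s, (c k ⬝ᵥ x) ^ 2 := by
  rw [gram, sum_mulVec, dotProduct_sum]
  refine Finset.sum_congr rfl fun k _ => ?_
  rw [vecMulVec_mulVec]
  simp [dotProduct_comm x, sq]

theorem indepFun_gram {c : ι → Ω → Fin n → ℝ} {s : Finset ι} {a : ι}
    (hc : IndepFun (fun ω (k : s) => c k ω) (c a) μ) {f : Matrix (Fin n) (Fin n) ℝ → ℝ} (hf : Continuous f)
    {g : (Fin n → ℝ) → ℝ} (hg : Measurable g) :
    IndepFun (fun ω => f (gram (fun k => c k ω) s)) (fun ω => g (c a ω)) μ := by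
  have hf' : Measurable fun x : s → Fin n → ℝ => f (gram x Finset.univ) := by
    refine Continuous.measurable ?_
    unfold gram
    fun_prop
  convert hc.comp hf' hg using 2 with ω
  · simp only [Function.comp, gram]
    rw [← Finset.sum_coe_sort]
  · rfl

variable [Finite Ω] [DiscreteMeasurableSpace Ω] [IsProbabilityMeasure μ]

/-- Independence allows `P` to be replaced by its entrywise mean, which is again positive
semidefinite. -/
theorem integral_quadForm_le {P : Ω → Matrix (Fin n) (Fin n) ℝ} {c : Ω → Fin n → ℝ} {σ : ℝ}
    (hP : ∀ ω, (P ω).PosSemidef)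
    (hi : ∀ i j, IndepFun (fun ω => P ω i j) (fun ω => c ω i * c ω j) μ)
    (hσ : ∀ Q : Matrix (Fin n) (Fin n) ℝ, Q.PosSemidef →
      ∫ ω, c ω ⬝ᵥ (Q *ᵥ c ω) ∂μ ≤ σ * Q.trace) :
    ∫ ω, c ω ⬝ᵥ (P ω *ᵥ c ω) ∂μ ≤ σ * ∫ ω, (P ω).trace ∂μ := by
  have hint : ∀ f : Ω → ℝ, Integrable f μ := fun f => .of_finite
  set Q : Matrix (Fin n) (Fin n) ℝ := .of fun i j => ∫ ω, P ω i j ∂μ with hQ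
  have hquad : ∀ x : Fin n → ℝ, x ⬝ᵥ (Q *ᵥ x) = ∫ ω, x ⬝ᵥ (P ω *ᵥ x) ∂μ := fun x => by
    simp only [dotProduct, mulVec, hQ, of_apply]
    rw [integral_finsetSum _ fun _ _ => hint _]
    refine Finset.sum_congr rfl fun i _ => ?_
    rw [integral_const_mul, integral_finsetSum _ fun _ _ => hint _]
    simp only [integral_mul_const]
  have hQpos : Q.PosSemidef := by
    refine PosSemidef.of_dotProduct_mulVec_nonneg ?_ fun x => ?_
    · ext i j
      simp only [hQ, conjTranspose_apply, of_apply, star_trivial]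
      exact integral_congr_ae (.of_forall fun ω => by simpa using (hP ω).1.apply i j)
    · simp only [star_trivial]
      rw [hquad]
      exact integral_nonneg fun ω => by simpa using (hP ω).dotProduct_mulVec_nonneg x
  have e1 : ∫ ω, c ω ⬝ᵥ (P ω *ᵥ c ω) ∂μ = ∫ ω, c ω ⬝ᵥ (Q *ᵥ c ω) ∂μ := by
    simp only [dotProduct, mulVec, Finset.mul_sum]
    rw [integral_finsetSum _ fun _ _ => hint _, integral_finsetSum _ fun _ _ => hint _]
    refine Finset.sum_congr rfl fun i _ => ?_
    rw [integral_finsetSum _ fun _ _ => hint _, integral_finsetSum _ fun _ _ => hint _]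
    refine Finset.sum_congr rfl fun j _ => ?_
    have := (hi i j).integral_fun_mul_eq_mul_integral (hint _).aestronglyMeasurable
      (hint _).aestronglyMeasurable
    calc _ = ∫ ω, P ω i j * (c ω i * c ω j) ∂μ := by congr 1; ext ω; ring
      _ = Q i j * ∫ ω, c ω i * c ω j ∂μ := this
      _ = _ := by rw [← integral_const_mul]; congr 1; ext ω; ring
  have e2 : ∫ ω, (P ω).trace ∂μ = Q.trace := by
    simp only [Matrix.trace, diag_apply, hQ, of_apply]
    exact integral_finsetSum _ fun _ _ => hint _
  rw [e1, e2]
  exact hσ Q hQpos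

/-- The numbers `q ! / θ ^ q` are the moments of an exponential variable. Used as a majorant, they
turn the binomial recursion into a partial sum of the series of `exp (θ R)`, so each step costs a
factor independent of `q`. -/
theorem sum_choose_mul_factorial_le {θ R : ℝ} (hθ : 0 < θ) (hR : 0 ≤ R) (q : ℕ) :
    ∑ r ∈ Finset.range q, q.choose (r + 1) * R ^ (r + 1) *
      (((q - (r + 1))! : ℝ) / θ ^ (q - (r + 1))) ≤ q ! / θ ^ q * (Real.exp (θ * R) - 1) := by
  have h := Real.sum_le_exp_of_nonneg (mul_nonneg hθ.le hR) (q + 1)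
  rw [Finset.sum_range_succ'] at h
  simp only [pow_zero, Nat.factorial_zero, Nat.cast_one, div_one] at h
  refine le_trans (le_of_eq ?_) (mul_le_mul_of_nonneg_left (le_sub_iff_add_le.2 h) (by positivity))
  rw [Finset.mul_sum]
  refine Finset.sum_congr rfl fun r hr => ?_
  have hr' : r + 1 ≤ q := Finset.mem_range.1 hr
  have hq : (q ! : ℝ) = q.choose (r + 1) * (r + 1)! * (q - (r + 1))! := by
    exact_mod_cast (Nat.choose_mul_factorial_mul_factorial hr').symm
  have hθq : θ ^ q = θ ^ (r + 1) * θ ^ (q - (r + 1)) := by rw [← pow_add]; congr 1; omega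
  rw [hq, hθq, mul_pow]
  have : ((r + 1)! : ℝ) ≠ 0 := by positivity
  field_simp

/-- Induction on the number of vectors, for all `q` at once because the recursion calls on every
lower moment. Each new vector multiplies the majorant by at most `1 + τ ≤ exp τ`. -/
theorem integral_trace_gram_pow_le {c : ι → Ω → Fin n → ℝ}
    (hc : ∀ (s : Finset ι) (a : ι), a ∉ s → IndepFun (fun ω (k : s) => c k ω) (c a) μ) {R σ θ : ℝ}
    (hR : 0 < R) (hσ0 : 0 ≤ σ) (hθ : 0 < θ) (hcR : ∀ k ω, c k ω ⬝ᵥ c k ω ≤ R)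
    (hσ : ∀ k, ∀ Q : Matrix (Fin n) (Fin n) ℝ, Q.PosSemidef →
      ∫ ω, c k ω ⬝ᵥ (Q *ᵥ c k ω) ∂μ ≤ σ * Q.trace) (s : Finset ι) : ∀ q : ℕ,
    ∫ ω, (gram (fun k => c k ω) s ^ q).trace ∂μ ≤
      n * (q ! / θ ^ q) * Real.exp (s.card * (σ * (Real.exp (θ * R) - 1) / R)) := by
  classical
  have hint : ∀ f : Ω → ℝ, Integrable f μ := fun f => .of_finite
  set τ := σ * (Real.exp (θ * R) - 1) / R with hτ
  induction s using Finset.induction_on with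
  | empty =>
    intro q
    rcases q with _ | q
    · simp [gram]
    · simp [gram]; positivity
  | insert a s ha ih =>
    intro q
    set A : Ω → Matrix (Fin n) (Fin n) ℝ := fun ω => gram (fun k => c k ω) s
    set P : Ω → Matrix (Fin n) (Fin n) ℝ := fun ω =>
      ∑ i ∈ Finset.range q, A ω ^ (q - 1 - i) * (A ω + R • 1) ^ i
    have hA : ∀ ω, (A ω).PosSemidef := fun ω => posSemidef_gram _ s
    have h1 : ∫ ω, (gram (fun k => c k ω) (insert a s) ^ q).trace ∂μ ≤
        ∫ ω, (A ω ^ q).trace ∂μ + ∫ ω, c a ω ⬝ᵥ (P ω *ᵥ c a ω) ∂μ := by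
      rw [← integral_add (hint _) (hint _)]
      refine integral_mono (hint _) (hint _) fun ω => ?_
      simp only [gram_insert _ ha]
      exact trace_rankOne_update_le (hA ω) (hcR a ω) q
    have h2 : ∫ ω, c a ω ⬝ᵥ (P ω *ᵥ c a ω) ∂μ ≤ σ * ∫ ω, (P ω).trace ∂μ := by
      refine integral_quadForm_le
        (fun ω => posSemidef_sum _ fun i _ => posSemidef_pow_mul_pow (hA ω) hR.le _ _)
        (fun i j => ?_) (hσ a)
      refine indepFun_gram (hc s a ha)
        (f := fun B => (∑ i ∈ Finset.range q, B ^ (q - 1 - i) * (B + R • 1) ^ i) i j)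
        (g := fun x => x i * x j) ?_ (by fun_prop)
      refine Continuous.matrix_elem ?_ i j
      fun_prop
    have h3 : R * ∫ ω, (P ω).trace ∂μ ≤
        n * Real.exp (s.card * τ) * (q ! / θ ^ q * (Real.exp (θ * R) - 1)) := by
      rw [← integral_const_mul]
      simp only [P, trace_sum_pow_mul_pow]
      rw [integral_finsetSum _ fun _ _ => hint _]
      refine le_trans ?_ (mul_le_mul_of_nonneg_left
        (sum_choose_mul_factorial_le hθ hR.le q) (by positivity))
      rw [Finset.mul_sum]
      refine Finset.sum_le_sum fun r _ => ?_
      rw [integral_const_mul]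
      refine (mul_le_mul_of_nonneg_left (ih (q - (r + 1))) (by positivity)).trans (le_of_eq ?_)
      ring
    rw [Finset.card_insert_of_notMem ha]
    set D := (n : ℝ) * (q ! / θ ^ q) * Real.exp (s.card * τ) with hD
    have h4 : ∫ ω, (P ω).trace ∂μ ≤ D * (Real.exp (θ * R) - 1) / R := by
      rw [le_div_iff₀ hR, mul_comm]
      exact h3.trans (le_of_eq (by rw [hD]; ring))
    have hD0 : 0 ≤ D := by positivity
    calc _ ≤ D + σ * (D * (Real.exp (θ * R) - 1) / R) :=
          h1.trans (add_le_add (ih q) (h2.trans (mul_le_mul_of_nonneg_left h4 hσ0)))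
      _ = D * (τ + 1) := by rw [hτ]; ring
      _ ≤ D * Real.exp τ := mul_le_mul_of_nonneg_left (Real.add_one_le_exp τ) hD0
      _ = _ := by rw [hD, mul_assoc, ← Real.exp_add]; congr 2; push_cast; ring

end MomentBound

/-! ### Independent edges, rows of the centred adjacency matrix, Chernoff bounds. -/

section EdgeModel

open MeasureTheory ProbabilityTheory unitInterval

variable {n : ℕ}

/-- The law of a family of independent edge indicators, supported off the diagonal. -/
noncomputable def edgeMeasure (n : ℕ) (p : unitInterval) : Measure (Sym2 (Fin n) → Prop) :=
  Measure.infinitePi fun e : Sym2 (Fin n) =>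
    toNNReal p • Measure.dirac (e ∈ (Sym2.diagSetᶜ : Set (Sym2 (Fin n)))) +
      toNNReal (σ p) • Measure.dirac False

/-- The graph whose edges are the pairs selected by `ω`. -/
def toGraph (ω : Sym2 (Fin n) → Prop) : SimpleGraph (Fin n) := SimpleGraph.fromEdgeSet {e | ω e}

instance (p : unitInterval) : IsProbabilityMeasure (edgeMeasure n p) := by
  unfold edgeMeasure; infer_instance

theorem binomialRandom_apply_toGraph (p : unitInterval) (S : Set (SimpleGraph (Fin n))) :
    SimpleGraph.binomialRandom (Fin n) p S = edgeMeasure n p {ω | toGraph ω ∈ S} := by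
  have hS : MeasurableSet S :=
    SimpleGraph.measurableEmbedding_edgeSet.measurableSet_image.1 .of_discrete
  rw [SimpleGraph.binomialRandom_eq_map, setBernoulli_eq_map,
    Measure.map_map SimpleGraph.measurable_fromEdgeSet .of_discrete,
    Measure.map_apply (SimpleGraph.measurable_fromEdgeSet.comp .of_discrete) hS]
  rfl

theorem integral_edge (p : unitInterval) {e : Sym2 (Fin n)} (he : ¬ e.IsDiag) (f : Prop → ℝ) :
    ∫ ω, f (ω e) ∂(edgeMeasure n p) = p * f True + (1 - p) * f False := by
  have h : (edgeMeasure n p).map (fun ω => ω e) =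
      toNNReal p • Measure.dirac True + toNNReal (σ p) • Measure.dirac False := by
    rw [edgeMeasure, Measure.infinitePi_map_eval]
    simp [he]
  have h2 := integral_map (μ := edgeMeasure n p) (φ := fun ω => ω e) (f := f)
    (measurable_pi_apply e).aemeasurable Measurable.of_discrete.aestronglyMeasurable
  rw [← h2, h, integral_add_measure .of_finite .of_finite, integral_smul_nnreal_measure,
    integral_smul_nnreal_measure, integral_dirac, integral_dirac]
  rfl

theorem iIndepFun_edge (p : unitInterval) :
    iIndepFun (fun (e : Sym2 (Fin n)) (ω : Sym2 (Fin n) → Prop) => ω e) (edgeMeasure n p) :=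
  iIndepFun_infinitePi (X := fun _ x => x) fun _ => measurable_id

open Classical in
/-- The `k`-th row of the strictly upper triangular part of the centred adjacency matrix. -/
noncomputable def row (p : ℝ) (k : Fin n) (ω : Sym2 (Fin n) → Prop) : Fin n → ℝ :=
  fun j => if k < j then (if ω s(k, j) then 1 else 0) - p else 0

/-- The pairs of vertices whose smaller element is `k`. -/
def rowEdges (k : Fin n) : Finset (Sym2 (Fin n)) := (Finset.Ioi k).image fun j => s(k, j)

theorem disjoint_rowEdges {k l : Fin n} (h : k ≠ l) : Disjoint (rowEdges k) (rowEdges l) := by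
  refine Finset.disjoint_left.2 fun e he he' => ?_
  simp only [rowEdges, Finset.mem_image, Finset.mem_Ioi] at he he'
  obtain ⟨j, hj, rfl⟩ := he
  obtain ⟨i, hi, h'⟩ := he'
  rw [Sym2.eq_iff] at h'
  rcases h' with ⟨h', _⟩ | ⟨h1, h2⟩
  · exact h h'.symm
  · subst h1 h2; exact lt_asymm hj hi

theorem mem_rowEdges {k j : Fin n} (h : k < j) : s(k, j) ∈ rowEdges k :=
  Finset.mem_image_of_mem _ (Finset.mem_Ioi.2 h)

open Classical in
theorem indepFun_rows (p : unitInterval) (t : ℝ) (s : Finset (Fin n)) (a : Fin n) (ha : a ∉ s) :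
    IndepFun (fun ω (k : s) => row t k ω) (row t a) (edgeMeasure n p) := by
  have hd : Disjoint (s.biUnion rowEdges) (rowEdges a) :=
    (Finset.disjoint_biUnion_left _ _ _).2 fun k hk =>
      disjoint_rowEdges fun h => ha (h ▸ hk)
  have h := (iIndepFun_edge (n := n) p).indepFun_finset _ _ hd fun e => measurable_pi_apply e
  have h2 := h.comp
    -- The arguments are defined only on the edges of the chosen rows, so the test `k < j` must
    -- supply the membership proof.
    (φ := fun x (k : s) j => if h : (k : Fin n) < j then
      (if x ⟨s(k, j), Finset.mem_biUnion.2 ⟨k, k.2, mem_rowEdges h⟩⟩ then (1 : ℝ) else 0) - t else 0)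
    (ψ := fun x j => if h : a < j then
      (if x ⟨s(a, j), mem_rowEdges h⟩ then (1 : ℝ) else 0) - t else 0)
    .of_discrete .of_discrete
  convert h2 using 2
  · ext k j
    simp only [row, Function.comp]
    split_ifs <;> rfl
  · ext ω j
    simp only [row, Function.comp]
    split_ifs <;> rfl

theorem iIndepFun_row_entries (p : unitInterval) (k : Fin n) :
    iIndepFun (fun (j : Finset.Ioi k) (ω : Sym2 (Fin n) → Prop) => ω s(k, j)) (edgeMeasure n p) :=
  (iIndepFun_edge (n := n) p).precomp (g := fun j : Finset.Ioi k => s(k, (j : Fin n)))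
    fun _ _ h => Subtype.ext (Sym2.congr_right.1 h)

theorem not_isDiag_of_lt {k j : Fin n} (h : k < j) : ¬ (s(k, j) : Sym2 (Fin n)).IsDiag := by
  simpa using h.ne

theorem integral_row_mul_row_of_ne (p : unitInterval) (k : Fin n) {i j : Fin n} (hij : i ≠ j) :
    ∫ ω, row p k ω i * row p k ω j ∂(edgeMeasure n p) = 0 := by
  classical
  by_cases hi : k < i
  swap; · simp [row, hi]
  by_cases hj : k < j
  swap; · simp [row, hj]
  have hne : (s(k, i) : Sym2 (Fin n)) ≠ s(k, j) :=
    fun h => hij (Sym2.congr_right.1 h)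
  have h := ((iIndepFun_edge (n := n) p).indepFun hne).comp
    (φ := fun x : Prop => (if x then (1 : ℝ) else 0) - p)
    (ψ := fun x : Prop => (if x then (1 : ℝ) else 0) - p) .of_discrete .of_discrete
  have h2 := h.integral_fun_mul_eq_mul_integral Measurable.of_discrete.aestronglyMeasurable
    Measurable.of_discrete.aestronglyMeasurable
  simp only [Function.comp] at h2
  simp only [row, hi, hj, if_true]
  rw [h2, integral_edge p (not_isDiag_of_lt hi) (fun x => (if x then (1 : ℝ) else 0) - p)]
  simp; ring_nf; simp

theorem integral_row_sq_le (p : unitInterval) (k i : Fin n) :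
    ∫ ω, row p k ω i * row p k ω i ∂(edgeMeasure n p) ≤ p := by
  classical
  by_cases hi : k < i
  swap; · simpa [row, hi] using p.2.1
  simp only [row, hi, if_true]
  rw [integral_edge p (not_isDiag_of_lt hi) (fun x => ((if x then (1 : ℝ) else 0) - p) *
    ((if x then (1 : ℝ) else 0) - p))]
  simp only [if_true, if_false]
  nlinarith [p.2.1, p.2.2, sq_nonneg (p : ℝ)]

/-- Distinct entries of a row are uncorrelated, so only the diagonal of `Q` contributes, with
variances at most `p`. -/
theorem integral_row_quadForm_le (p : unitInterval) (k : Fin n)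
    {Q : Matrix (Fin n) (Fin n) ℝ} (hQ : Q.PosSemidef) :
    ∫ ω, row p k ω ⬝ᵥ (Q *ᵥ row p k ω) ∂(edgeMeasure n p) ≤ p * Q.trace := by
  have hint : ∀ f : (Sym2 (Fin n) → Prop) → ℝ, Integrable f (edgeMeasure n p) :=
    fun f => .of_finite
  have e : ∀ ω, row p k ω ⬝ᵥ (Q *ᵥ row p k ω) =
      ∑ i, ∑ j, Q i j * (row p k ω i * row p k ω j) := fun ω => by
    simp only [dotProduct, mulVec, Finset.mul_sum]
    exact Finset.sum_congr rfl fun i _ => Finset.sum_congr rfl fun j _ => by ring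
  simp only [e]
  rw [integral_finsetSum _ fun _ _ => hint _, Matrix.trace, Finset.mul_sum]
  refine Finset.sum_le_sum fun i _ => ?_
  rw [integral_finsetSum _ fun _ _ => hint _, Finset.sum_eq_single i]
  · rw [integral_const_mul, mul_comm (p : ℝ)]
    exact mul_le_mul_of_nonneg_left (integral_row_sq_le p k i) hQ.diag_nonneg
  · intro j _ hj
    rw [integral_const_mul, integral_row_mul_row_of_ne p k hj.symm, mul_zero]
  · simp

/-- A vector, replaced by zero when its squared length exceeds `R`. -/
noncomputable def truncate (R : ℝ) (c : Fin n → ℝ) : Fin n → ℝ := if c ⬝ᵥ c ≤ R then c else 0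

theorem measurable_truncate (R : ℝ) : Measurable (truncate (n := n) R) :=
  Measurable.ite (measurableSet_le (by unfold dotProduct; fun_prop) measurable_const)
    measurable_id measurable_const

theorem truncate_dotProduct_le {R : ℝ} (hR : 0 ≤ R) (c : Fin n → ℝ) :
    truncate R c ⬝ᵥ truncate R c ≤ R := by
  unfold truncate; split_ifs with h
  · exact h
  · simpa using hR

theorem truncate_quadForm_le (R : ℝ) (c : Fin n → ℝ) {Q : Matrix (Fin n) (Fin n) ℝ}
    (hQ : Q.PosSemidef) : truncate R c ⬝ᵥ (Q *ᵥ truncate R c) ≤ c ⬝ᵥ (Q *ᵥ c) := by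
  unfold truncate; split_ifs with h
  · exact le_rfl
  · simpa using hQ.dotProduct_mulVec_nonneg c

/-- Truncation makes the length bound `R` hold surely, keeps the rows independent and only decreases
their quadratic forms. -/
theorem integral_trace_gram_truncate_row_le (p : unitInterval) {R θ : ℝ} (hR : 0 < R)
    (hθ : 0 < θ) (q : ℕ) :
    ∫ ω, (gram (fun k => truncate R (row p k ω)) Finset.univ ^ q).trace ∂(edgeMeasure n p) ≤
      n * (q.factorial / θ ^ q) * Real.exp (n * (p * (Real.exp (θ * R) - 1) / R)) := by
  have h := integral_trace_gram_pow_le (μ := edgeMeasure n p)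
    (c := fun k ω => truncate R (row p k ω))
    (fun s a ha => (indepFun_rows p p s a ha).comp
      (φ := fun (x : s → Fin n → ℝ) k => truncate R (x k))
      (measurable_pi_lambda _ fun k => (measurable_truncate R).comp (measurable_pi_apply k))
      (measurable_truncate R))
    hR p.2.1 hθ (fun k ω => truncate_dotProduct_le hR.le _)
    (fun k Q hQ => (integral_mono .of_finite .of_finite fun ω =>
      truncate_quadForm_le R _ hQ).trans (integral_row_quadForm_le p k hQ)) Finset.univ q
  simpa using h

/-- Chernoff's bound at parameter one. The chord bound `exp y ≤ 1 + 2 y` on `[0, 1]` gives each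
squared entry an exponential moment of at most `1 + 2 p (1 - p) ≤ exp (2 p)`. -/
theorem measureReal_row_large_le (p : unitInterval) (k : Fin n) (R : ℝ) :
    (edgeMeasure n p).real {ω | R ≤ row p k ω ⬝ᵥ row p k ω} ≤ Real.exp (2 * (n * p) - R) := by
  classical
  have hp0 := p.2.1
  have hp1 := p.2.2
  let f : Prop → ℝ := fun x => ((if x then 1 else 0) - (p : ℝ)) ^ 2
  let X : Finset.Ioi k → (Sym2 (Fin n) → Prop) → ℝ := fun j ω => f (ω s(k, j))
  have hX : iIndepFun X (edgeMeasure n p) :=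
    (iIndepFun_row_entries p k).comp (fun _ => f) fun _ => .of_discrete
  have hsum : ∀ ω, row p k ω ⬝ᵥ row p k ω = (∑ j, X j) ω := fun ω => by
    rw [Finset.sum_apply, Finset.sum_coe_sort (Finset.Ioi k) fun j => f (ω s(k, j)), dotProduct]
    rw [← Finset.filter_lt_eq_Ioi, Finset.sum_filter]
    refine Finset.sum_congr rfl fun j _ => ?_
    simp only [row, f]
    split_ifs <;> ring
  have hf1 : ∀ y : ℝ, 0 ≤ y → y ≤ 1 → Real.exp y ≤ 1 + 2 * y := fun y h0 h1 => by
    have h2 := convexOn_exp.2 (Set.mem_univ 0) (Set.mem_univ 1) (sub_nonneg.2 h1) h0 (by ring)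
    simp only [smul_eq_mul, mul_zero, mul_one, zero_add, Real.exp_zero] at h2
    nlinarith [Real.exp_one_lt_three]
  have hmgf : ∀ j, mgf (X j) (edgeMeasure n p) 1 ≤ Real.exp (2 * p) := fun j => by
    rw [mgf]
    have := integral_edge p (not_isDiag_of_lt (Finset.mem_Ioi.1 j.2)) fun x => Real.exp (1 * f x)
    refine this.trans_le ?_
    have t1 := hf1 ((1 - p) ^ 2) (by positivity) (by nlinarith)
    have t2 := hf1 ((0 - p) ^ 2) (by positivity) (by nlinarith)
    simp only [f, if_true, if_false, one_mul]
    have t3 := Real.add_one_le_exp (2 * (p : ℝ))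
    have t4 := mul_le_mul_of_nonneg_left t1 hp0
    have t5 := mul_le_mul_of_nonneg_left t2 (sub_nonneg.2 hp1)
    nlinarith [sq_nonneg (p : ℝ)]
  have h := measure_ge_le_exp_mul_mgf (μ := edgeMeasure n p) (X := ∑ j, X j) (t := 1) R
    zero_le_one .of_finite
  simp only [hsum]
  refine h.trans ?_
  rw [hX.mgf_sum (fun _ => .of_discrete)]
  have hprod : ∏ j, mgf (X j) (edgeMeasure n p) 1 ≤ Real.exp (2 * (n * p)) := by
    refine (Finset.prod_le_prod (fun _ _ => mgf_nonneg) fun j _ => hmgf j).trans ?_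
    rw [Finset.prod_const, ← Real.exp_nat_mul]
    refine Real.exp_le_exp.2 ?_
    have : ((Finset.univ : Finset (Finset.Ioi k)).card : ℝ) ≤ n := by
      have := Finset.card_le_univ (Finset.Ioi k)
      simp only [Finset.card_univ, Fintype.card_coe, Fintype.card_fin] at this ⊢
      exact_mod_cast this
    nlinarith
  refine (mul_le_mul_of_nonneg_left hprod (Real.exp_nonneg _)).trans (le_of_eq ?_)
  rw [← Real.exp_add]
  congr 1; ring

open Classical in
theorem numEdges_toGraph (ω : Sym2 (Fin n) → Prop) :
    (numEdges (toGraph ω) : ℝ) =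
      ∑ e : {e : Sym2 (Fin n) // ¬ e.IsDiag}, if ω e then 1 else 0 := by
  have h : (toGraph ω).edgeSet = ↑(Finset.univ.filter fun e : Sym2 (Fin n) => ¬ e.IsDiag ∧ ω e) := by
    ext e
    simp [toGraph, SimpleGraph.edgeSet_fromEdgeSet, and_comm]
  rw [numEdges, h, Set.ncard_coe_finset, ← Finset.filter_filter, Finset.card_filter,
    Nat.cast_sum]
  push_cast
  exact Finset.sum_subtype _ (by simp) _

theorem measureReal_numEdges_small_le (p : unitInterval) :
    (edgeMeasure n p).real {ω | (numEdges (toGraph ω) : ℝ) ≤ n.choose 2 * p / 2} ≤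
      Real.exp (-(n.choose 2 * p / 10)) := by
  classical
  have hp0 := p.2.1
  have hp1 := p.2.2
  let f : Prop → ℝ := fun x => if x then 1 else 0
  let X : {e : Sym2 (Fin n) // ¬ e.IsDiag} → (Sym2 (Fin n) → Prop) → ℝ := fun e ω => f (ω e)
  have hX : iIndepFun X (edgeMeasure n p) :=
    ((iIndepFun_edge p).precomp Subtype.val_injective).comp (fun _ => f) fun _ => .of_discrete
  have hsum : ∀ ω, (numEdges (toGraph ω) : ℝ) = (∑ e, X e) ω := fun ω => by
    rw [numEdges_toGraph, Finset.sum_apply]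
  -- Since `exp (-1) < 0.4`, the moment `1 - p + p exp (-1)` is at most `1 - 0.6 p`; the excess of
  -- `0.6` over the threshold `1 / 2` gives the exponent `1 / 10`.
  have hmgf : ∀ e, mgf (X e) (edgeMeasure n p) (-1) ≤ Real.exp (-(6 / 10 * p)) := fun e => by
    rw [mgf]
    refine (integral_edge p e.2 fun x => Real.exp (-1 * f x)).trans_le ?_
    simp only [f, if_true, if_false, mul_one, mul_zero, Real.exp_zero]
    have t3 := Real.add_one_le_exp (-(6 / 10 * (p : ℝ)))
    have := Real.exp_neg_one_lt_d9
    nlinarith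
  have h := measure_le_le_exp_mul_mgf (μ := edgeMeasure n p) (X := ∑ e, X e) (t := -1)
    (n.choose 2 * p / 2) (by norm_num) .of_finite
  simp only [hsum]
  refine h.trans ?_
  rw [hX.mgf_sum (fun _ => .of_discrete)]
  have hcard : ((Finset.univ : Finset {e : Sym2 (Fin n) // ¬ e.IsDiag}).card : ℝ) =
      n.choose 2 := by
    rw [Finset.card_univ, Sym2.card_subtype_not_diag, Fintype.card_fin]
  refine (mul_le_mul_of_nonneg_left
    (Finset.prod_le_prod (fun _ _ => mgf_nonneg) fun e _ => hmgf e) (Real.exp_nonneg _)).trans ?_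
  rw [Finset.prod_const, ← Real.exp_nat_mul, hcard, ← Real.exp_add]
  refine Real.exp_le_exp.2 (le_of_eq ?_)
  ring

theorem adj_toGraph_of_lt (ω : Sym2 (Fin n) → Prop) (p : ℝ) {k j : Fin n} (h : k < j) :
    adj (toGraph ω) k j = row p k ω j + p := by
  classical
  rw [adj, SimpleGraph.adjMatrix_apply]
  simp [toGraph, row, h, h.ne]

theorem neg_quadForm_adj_le (ω : Sym2 (Fin n) → Prop) {p : ℝ} (hp : 0 ≤ p) {x : Fin n → ℝ}
    (hx : x ⬝ᵥ x = 1) :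
    -(x ⬝ᵥ (adj (toGraph ω) *ᵥ x)) ≤
      2 * √(x ⬝ᵥ (gram (fun k => row p k ω) Finset.univ *ᵥ x)) + p := by
  classical
  set W := adj (toGraph ω)
  have hsymm : ∀ i j, W i j = W j i := fun i j => by
    simpa using (adj_isHermitian (toGraph ω)).apply j i
  have hdiag : ∀ i, W i i = 0 := fun i => by simp [W, adj]
  -- split a symmetric double sum into its diagonal and twice its upper part
  have split : ∀ F : Fin n → Fin n → ℝ, (∀ i j, F i j = F j i) →
      ∑ i, ∑ j, F i j = ∑ i, F i i + 2 * ∑ i, ∑ j, if i < j then F i j else 0 := by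
    intro F hF
    have h1 : ∀ i j, F i j = (if i = j then F i j else 0) + (if i < j then F i j else 0) +
        (if j < i then F j i else 0) := fun i j => by
      rcases lt_trichotomy i j with h | h | h
      · simp [h, h.ne, h.not_gt]
      · simp [h]
      · simp [h, h.ne', h.not_gt, hF i j]
    rw [Finset.sum_congr rfl fun i _ => Finset.sum_congr rfl fun j _ => h1 i j]
    simp only [Finset.sum_add_distrib]
    rw [Finset.sum_comm (f := fun i j => if j < i then F j i else 0)]
    simp
    ring
  have e1 : x ⬝ᵥ (W *ᵥ x) = 2 * ∑ k, x k * (row p k ω ⬝ᵥ x) +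
      2 * ∑ i, ∑ j, if i < j then p * (x i * x j) else 0 := by
    have : x ⬝ᵥ (W *ᵥ x) = ∑ i, ∑ j, x i * x j * W i j := by
      simp only [dotProduct, mulVec, Finset.mul_sum]
      exact Finset.sum_congr rfl fun i _ => Finset.sum_congr rfl fun j _ => by ring
    rw [this, split _ fun i j => by rw [hsymm]; ring]
    simp only [hdiag, mul_zero, Finset.sum_const_zero, zero_add]
    rw [← mul_add, ← Finset.sum_add_distrib]
    congr 1
    refine Finset.sum_congr rfl fun k _ => ?_
    rw [dotProduct, Finset.mul_sum, ← Finset.sum_add_distrib]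
    refine Finset.sum_congr rfl fun j _ => ?_
    by_cases h : k < j
    · rw [if_pos h, if_pos h, show W k j = row p k ω j + p from adj_toGraph_of_lt ω p h]; ring
    · simp [row, h]
  -- The mean part is `p (J - I)`: the `J` term is nonnegative and will be dropped, and the missing
  -- diagonal costs `p`.
  have e2 : p * (∑ i, x i) ^ 2 = p + 2 * ∑ i, ∑ j, if i < j then p * (x i * x j) else 0 := by
    have := split (fun i j => p * (x i * x j)) fun i j => by ring
    rw [← Finset.mul_sum, ← dotProduct, hx, mul_one] at this
    rw [← this, sq, Finset.sum_mul_sum]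
    simp only [Finset.mul_sum]
  -- Cauchy–Schwarz: `|xᵀ U x| ≤ ‖U x‖` for a unit vector `x`.
  have e3 : |∑ k, x k * (row p k ω ⬝ᵥ x)| ≤
      √(x ⬝ᵥ (gram (fun k => row p k ω) Finset.univ *ᵥ x)) := by
    refine Real.abs_le_sqrt ?_
    rw [dotProduct_gram_mulVec]
    refine (Finset.sum_mul_sq_le_sq_mul_sq _ _ _).trans (le_of_eq ?_)
    have : ∑ i, x i ^ 2 = 1 := by rw [← hx, dotProduct]; simp [sq]
    rw [this, one_mul]
  have e4 := neg_abs_le (∑ k, x k * (row p k ω ⬝ᵥ x))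
  have e5 : 0 ≤ p * (∑ i, x i) ^ 2 := by positivity
  linarith

end EdgeModel

/-! ### The linear program between the maximum cut and the eigenvalue bound. -/

section Certificate

variable {n : ℕ} (G : SimpleGraph (Fin n))

theorem minEigenvalue_mul_le (x : Fin n → ℝ) :
    minEigenvalue G * (x ⬝ᵥ x) ≤ x ⬝ᵥ (adj G *ᵥ x) := by
  have hA := adj_isHermitian G
  rw [quadForm_eq_sum hA.eigenvectorBasis (eigenvectorBasis_mulVec hA),
    dotProduct_self_eq_sum hA.eigenvectorBasis, Finset.mul_sum]
  exact Finset.sum_le_sum fun i _ => mul_le_mul_of_nonneg_right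
    (ciInf_le (Set.finite_range _).bddBelow i) (sq_nonneg _)

theorem exists_quadForm_eq_minEigenvalue (hn : 0 < n) :
    ∃ x : Fin n → ℝ, x ⬝ᵥ x = 1 ∧ x ⬝ᵥ (adj G *ᵥ x) = minEigenvalue G := by
  have : Nonempty (Fin n) := ⟨⟨0, hn⟩⟩
  have hA := adj_isHermitian G
  obtain ⟨i, hi⟩ := exists_eq_ciInf_of_finite (f := hA.eigenvalues)
  have h1 := basis_dotProduct hA.eigenvectorBasis i i
  rw [if_pos rfl] at h1
  refine ⟨_, h1, ?_⟩
  rw [eigenvectorBasis_mulVec hA, dotProduct_smul, h1, smul_eq_mul, mul_one, hi, minEigenvalue]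

/-- The adjacency matrix has trace zero, so its least eigenvalue is not positive. This gives `Q ≥
1`, the lower half of the convergence for dense graphs. -/
theorem chi_nonneg : 0 ≤ chi G := by
  classical
  have h := trace_eq_sum_of_eigen _ (eigenvectorBasis_mulVec (adj_isHermitian G))
  have h0 : (adj G).trace = 0 := by rw [adj, SimpleGraph.trace_adjMatrix]
  have h1 : ∑ _i : Fin n, minEigenvalue G ≤ ∑ i, (adj_isHermitian G).eigenvalues i :=
    Finset.sum_le_sum fun i _ => ciInf_le (Set.finite_range _).bddBelow i
  rw [← h, h0] at h1
  simp only [Finset.sum_const, Finset.card_univ, Fintype.card_fin, nsmul_eq_mul] at h1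
  rw [chi]; linarith

theorem sum_adj : ∑ i, ∑ j, adj G i j = 2 * numEdges G := by
  classical
  have h := G.sum_degrees_eq_twice_card_edges
  have h2 : G.edgeFinset.card = numEdges G := by
    rw [numEdges, ← SimpleGraph.coe_edgeFinset, Set.ncard_coe_finset]
  rw [h2] at h
  have h3 : ∀ i, ∑ j, adj G i j = G.degree i := fun i => by
    simp [adj, SimpleGraph.adjMatrix_apply, ← SimpleGraph.card_neighborFinset_eq_degree,
      SimpleGraph.neighborFinset_eq_filter]
  simp only [h3]
  exact_mod_cast h

open Classical in
theorem card_interedges (S T : Finset (Fin n)) :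
    ((G.interedges S T).card : ℝ) = ∑ i ∈ S, ∑ j ∈ T, adj G i j := by
  rw [SimpleGraph.interedges, Rel.interedges, Finset.card_filter, Finset.sum_product]
  simp [adj, SimpleGraph.adjMatrix_apply]

theorem lpObjective_eq (X : Matrix (Fin n) (Fin n) ℝ) :
    lpObjective G X = 1 / 2 * numEdges G - 1 / 4 * (X * adj G).trace := by
  have h : (adj G)ᵀ = adj G := by simpa using (adj_isHermitian G).eq
  rw [lpObjective, transpose_neg, h, neg_mul, trace_neg, Matrix.trace_mul_comm]
  ring

/-- The `±1` vector of a vertex set. -/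
def signVec (S : Finset (Fin n)) : Fin n → ℝ := fun i => if i ∈ S then 1 else -1

theorem signVec_mul_self (S : Finset (Fin n)) (i : Fin n) : signVec S i * signVec S i = 1 := by
  unfold signVec; split_ifs <;> norm_num

theorem abs_signVec (S : Finset (Fin n)) (i : Fin n) : |signVec S i| = 1 := by
  unfold signVec; split_ifs <;> norm_num

theorem vecMulVec_signVec_mem_lpFeasible (S : Finset (Fin n)) (B : Set (Fin n → ℝ)) :
    vecMulVec (signVec S) (signVec S) ∈ lpFeasible B := by
  refine ⟨?_, fun v _ => ?_, fun i => ?_, fun i j => ?_⟩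
  · ext i j; simp [vecMulVec_apply, mul_comm]
  · simpa using (posSemidef_vecMulVec (signVec S)).dotProduct_mulVec_nonneg v
  · rw [vecMulVec_apply, signVec_mul_self]
  · rw [vecMulVec_apply, abs_mul, abs_signVec, abs_signVec, one_mul]

open Classical in
theorem lpObjective_signVec (S : Finset (Fin n)) :
    lpObjective G (vecMulVec (signVec S) (signVec S)) = (G.interedges S Sᶜ).card := by
  have hsymm : ∀ i j, adj G i j = adj G j i := fun i j => by
    simpa using (adj_isHermitian G).apply j i
  have e1 : (vecMulVec (signVec S) (signVec S) * adj G).trace =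
      ∑ i, ∑ j, adj G i j * (signVec S i * signVec S j) := by
    rw [trace_vecMulVec_mul]
    simp only [dotProduct, mulVec, Finset.mul_sum]
    exact Finset.sum_congr rfl fun i _ => Finset.sum_congr rfl fun j _ => by ring
  -- The product of signs is `1` minus twice the indicator that the pair is cut, counted separately
  -- for the two orientations.
  have e2 : ∀ i j, adj G i j * (signVec S i * signVec S j) = adj G i j -
      2 * (if i ∈ S then if j ∈ Sᶜ then adj G i j else 0 else 0) -
      2 * (if j ∈ S then if i ∈ Sᶜ then adj G j i else 0 else 0) := fun i j => by
    rw [hsymm j i]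
    by_cases hi : i ∈ S <;> by_cases hj : j ∈ S <;> simp [signVec, hi, hj] <;> ring
  have e3 : ∑ i, ∑ j, (if i ∈ S then if j ∈ Sᶜ then adj G i j else 0 else 0) =
      ∑ i ∈ S, ∑ j ∈ Sᶜ, adj G i j := by
    have : ∀ i, ∑ j, (if i ∈ S then if j ∈ Sᶜ then adj G i j else 0 else 0) =
        if i ∈ S then ∑ j ∈ Sᶜ, adj G i j else 0 := fun i => by
      split_ifs
      · rw [Finset.sum_ite_mem, Finset.univ_inter]
      · simp
    simp only [this]
    rw [Finset.sum_ite_mem, Finset.univ_inter]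
  rw [lpObjective_eq, e1, card_interedges]
  simp only [e2, Finset.sum_sub_distrib, ← Finset.mul_sum]
  rw [Finset.sum_comm (f := fun i j => if j ∈ S then if i ∈ Sᶜ then adj G j i else 0 else 0),
    e3, sum_adj]
  ring

theorem isCompact_lpFeasible (B : Set (Fin n → ℝ)) : IsCompact (lpFeasible B) := by
  have hK : IsCompact (Set.pi Set.univ fun _ : Fin n => Set.pi Set.univ fun _ : Fin n =>
      Set.Icc (-1 : ℝ) 1) := isCompact_univ_pi fun _ => isCompact_univ_pi fun _ => isCompact_Icc
  have e : lpFeasible B = {X | Xᵀ = X} ∩ ((⋂ v ∈ B, {X | 0 ≤ v ⬝ᵥ (X *ᵥ v)}) ∩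
      ((⋂ i, {X | X i i = 1}) ∩ ⋂ i, ⋂ j, {X | |X i j| ≤ 1})) := by
    ext X; simp [lpFeasible, IsSymm]
  refine hK.of_isClosed_subset ?_ fun X hX i _ j _ => abs_le.1 (hX.2.2.2 i j)
  rw [e]
  refine IsClosed.inter ?_ (IsClosed.inter ?_ (IsClosed.inter ?_ ?_))
  · exact isClosed_eq (by fun_prop) (by fun_prop)
  · exact isClosed_iInter fun v => isClosed_iInter fun _ =>
      isClosed_le continuous_const (by fun_prop)
  · exact isClosed_iInter fun i => isClosed_eq (by fun_prop) continuous_const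
  · exact isClosed_iInter fun i => isClosed_iInter fun j =>
      isClosed_le (by fun_prop) continuous_const

theorem lpObjective_le_eigenvalueBound {B : Set (Fin n → ℝ)} (hB : IsEigenbasis G B)
    {X : Matrix (Fin n) (Fin n) ℝ} (hX : X ∈ lpFeasible B) :
    lpObjective G X ≤ eigenvalueBound G := by
  obtain ⟨b, hb, rfl⟩ := hB
  choose t ht using hb
  have ht' : ∀ i, minEigenvalue G ≤ t i := fun i => by
    have h := minEigenvalue_mul_le G (b i).ofLp
    have h1 := basis_dotProduct b i i
    rw [if_pos rfl] at h1
    rwa [ht, dotProduct_smul, h1, smul_eq_mul, mul_one, mul_one] at h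
  have e1 : X.trace = n := by simp [Matrix.trace, hX.2.2.1]
  have e2 : minEigenvalue G * n ≤ (X * adj G).trace := by
    -- Both traces are evaluated in the eigenbasis; the constraints `vᵀ X v ≥ 0` are exactly what
    -- allows each eigenvalue to be replaced by the least one.
    rw [← e1, trace_eq_sum_quadForm b X, trace_eq_sum_quadForm b, Finset.mul_sum]
    refine Finset.sum_le_sum fun i _ => ?_
    rw [← mulVec_mulVec, ht, mulVec_smul, dotProduct_smul, smul_eq_mul]
    exact mul_le_mul_of_nonneg_right (ht' i) (hX.2.1 _ ⟨i, rfl⟩)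
  rw [lpObjective_eq, eigenvalueBound, chi]
  linarith

theorem isEigenbasis_eigenvectorBasis : IsEigenbasis G
    (Set.range fun i => ((adj_isHermitian G).eigenvectorBasis i).ofLp) :=
  ⟨_, fun i => ⟨_, eigenvectorBasis_mulVec (adj_isHermitian G) i⟩, rfl⟩

theorem exists_lpObjective_eq_maxCut (B : Set (Fin n → ℝ)) :
    ∃ X ∈ lpFeasible B, lpObjective G X = maxCut G := by
  classical
  obtain ⟨S, -, hS⟩ := Finset.exists_mem_eq_sup (Finset.univ : Finset (Finset (Fin n)))
    Finset.univ_nonempty fun S => (G.interedges S Sᶜ).card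
  refine ⟨_, vecMulVec_signVec_mem_lpFeasible S B, ?_⟩
  rw [lpObjective_signVec, maxCut]
  congr 1
  convert hS.symm

theorem certifies_of_numEdges_pos (hm : 0 < numEdges G) : Certifies G := by
  refine ⟨hm, fun B hB => ?_, ?_⟩
  · obtain ⟨Y, hY, hYc⟩ := exists_lpObjective_eq_maxCut G B
    have hcont : Continuous (lpObjective G) := by unfold lpObjective; fun_prop
    obtain ⟨Z, hZ, hmax⟩ := (isCompact_lpFeasible B).exists_isMaxOn ⟨Y, hY⟩ hcont.continuousOn
    refine ⟨lpObjective G Z, ⟨⟨Z, hZ, rfl⟩, ?_⟩, hYc ▸ hmax hY,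
      lpObjective_le_eigenvalueBound G hB hZ⟩
    rintro _ ⟨X, hX, rfl⟩
    exact hmax hX
  · obtain ⟨Y, hY, hYc⟩ := exists_lpObjective_eq_maxCut G _
    have := lpObjective_le_eigenvalueBound G (isEigenbasis_eigenvectorBasis G) hY
    rw [quotient, ← hYc]
    exact div_le_div_of_nonneg_right this (by positivity)

theorem quotient_eq (hm : 0 < numEdges G) : quotient G = 1 + chi G / (2 * numEdges G) := by
  have : (0 : ℝ) < numEdges G := by exact_mod_cast hm
  rw [quotient, eigenvalueBound]
  field_simp
  ring

end Certificate

/-! ### Choice of parameters and asymptotics. -/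

section HighProbability

open MeasureTheory Filter Topology

variable {n : ℕ}

theorem measureReal_trace_large_le (p : unitInterval) {R θ L : ℝ} (hR : 0 < R) (hθ : 0 < θ)
    (hL : 0 < L) (q : ℕ) :
    (edgeMeasure n p).real
        {ω | L ^ q ≤ (gram (fun k => truncate R (row p k ω)) Finset.univ ^ q).trace} ≤
      n * (q.factorial / (θ * L) ^ q) * Real.exp (n * (p * (Real.exp (θ * R) - 1) / R)) := by
  have h1 := mul_meas_ge_le_integral_of_nonneg (μ := edgeMeasure n p)
    (f := fun ω => (gram (fun k => truncate R (row p k ω)) Finset.univ ^ q).trace)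
    (.of_forall fun ω => ((posSemidef_gram _ _).pow q).trace_nonneg) .of_finite (L ^ q)
  have h2 := h1.trans (integral_trace_gram_truncate_row_le p hR hθ q)
  rw [mul_comm, ← le_div_iff₀ (by positivity)] at h2
  refine h2.trans (le_of_eq ?_)
  rw [mul_pow]
  field_simp

/-- If every row is short, truncation changes nothing, and a least eigenvector forces the top
eigenvalue of the Gram matrix above `L`, hence its trace moment above `L ^ q`. -/
theorem exists_large_of_minEigenvalue_lt (ω : Sym2 (Fin n) → Prop) {p R L : ℝ} (hn : 0 < n)
    (hp : 0 ≤ p) (hL : 0 ≤ L) (h : 2 * √L + p < -minEigenvalue (toGraph ω)) (q : ℕ) :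
    (∃ k, R ≤ row p k ω ⬝ᵥ row p k ω) ∨
      L ^ q ≤ (gram (fun k => truncate R (row p k ω)) Finset.univ ^ q).trace := by
  by_contra! hc
  obtain ⟨hc1, hc2⟩ := hc
  have e : (fun k => truncate R (row p k ω)) = fun k => row p k ω := by
    ext1 k; rw [truncate, if_pos (hc1 k).le]
  rw [e] at hc2
  obtain ⟨x, hx, hxm⟩ := exists_quadForm_eq_minEigenvalue (toGraph ω) hn
  have h1 := neg_quadForm_adj_le ω hp hx
  rw [hxm] at h1
  have h2 : √L < √(x ⬝ᵥ (gram (fun k => row p k ω) Finset.univ *ᵥ x)) := by linarith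
  have h3 := (Real.lt_sqrt (Real.sqrt_nonneg _)).1 h2
  rw [Real.sq_sqrt hL] at h3
  have h4 := quadForm_pow_le_trace_pow (posSemidef_gram (fun k => row p k ω) Finset.univ) hx q
  exact absurd (pow_le_pow_left₀ hL h3.le q) (not_le.2 (h4.trans_lt hc2))

/-- The event that the number of edges is not too small and the least eigenvalue is bounded. -/
def IsTypical (n : ℕ) (p L : ℝ) (G : SimpleGraph (Fin n)) : Prop :=
  n.choose 2 * p / 2 < numEdges G ∧ -minEigenvalue G ≤ 2 * √L + p

theorem measureReal_not_isTypical_le (p : unitInterval) (hn : 0 < n) {R θ L : ℝ} (hR : 0 < R)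
    (hθ : 0 < θ) (hL : 0 < L) (q : ℕ) :
    (edgeMeasure n p).real {ω | ¬ IsTypical n p L (toGraph ω)} ≤
      n * Real.exp (2 * (n * p) - R) +
      n * (q.factorial / (θ * L) ^ q) * Real.exp (n * (p * (Real.exp (θ * R) - 1) / R)) +
      Real.exp (-(n.choose 2 * p / 10)) := by
  have hsub : {ω | ¬ IsTypical n p L (toGraph ω)} ⊆
      ((⋃ k : Fin n, {ω | R ≤ row p k ω ⬝ᵥ row p k ω}) ∪
      {ω | L ^ q ≤ (gram (fun k => truncate R (row p k ω)) Finset.univ ^ q).trace}) ∪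
      {ω | (numEdges (toGraph ω) : ℝ) ≤ n.choose 2 * p / 2} := by
    intro ω hω
    rw [Set.mem_ofPred_eq, IsTypical, not_and_or, not_lt, not_le] at hω
    rcases hω with hω | hω
    · exact Or.inr hω
    · rcases exists_large_of_minEigenvalue_lt ω (R := R) hn p.2.1 hL.le hω q with ⟨k, hk⟩ | h
      · exact Or.inl (Or.inl (Set.mem_iUnion.2 ⟨k, hk⟩))
      · exact Or.inl (Or.inr h)
  refine (measureReal_mono hsub).trans ((measureReal_union_le _ _).trans (add_le_add
    ((measureReal_union_le _ _).trans (add_le_add ?_ ?_)) ?_))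
  · refine (measureReal_iUnion_fintype_le _).trans ?_
    refine (Finset.sum_le_sum fun k _ => measureReal_row_large_le p k R).trans (le_of_eq ?_)
    simp
  · exact measureReal_trace_large_le p hR hθ hL q
  · exact measureReal_numEdges_small_le p

theorem choose_two_mul_ge {p : ℝ} (hp : 0 ≤ p) (hn : 2 ≤ n) : n * (n * p) / 4 ≤ n.choose 2 * p := by
  have h2 : (2 : ℝ) ≤ n := by exact_mod_cast hn
  rw [Nat.cast_choose_two]
  nlinarith [mul_nonneg (mul_nonneg hp (Nat.cast_nonneg n)) (sub_nonneg.2 h2)]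

theorem measureReal_not_isTypical_le_of_log_le {c : ℝ} (hc : 0 < c) : ∃ C : ℝ, ∀ n : ℕ,
    1 ≤ Real.log n → ∀ p : unitInterval, c * Real.log n ≤ n * p →
    (edgeMeasure n p).real {ω | ¬ IsTypical n p (n * p * Real.log n / 256) (toGraph ω)} ≤
      C / n + Real.exp (-(c / 40 * n)) := by
  -- With `R = K d`, the row bound becomes `exp (-(2 / c) d) ≤ n ^ (-2)`, which survives the union
  -- over `n` rows.
  set K := 2 + 2 / c with hK
  have hK0 : 0 < K := by positivity
  -- Chosen so that `θ L = 3 e log n`. As `q ≤ 3 log n`, the ratio `q ! / (θ L) ^ q` is at most `exp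
  -- (-q) ≤ n ^ (-2)`, and the exponential factor of the moment bound is the constant `D`.
  set a := 768 * K * Real.exp 1 with ha
  have ha0 : 0 < a := by positivity
  set D := Real.exp ((Real.exp a - 1) / K) with hD
  refine ⟨1 + D, fun n hlog p hp => ?_⟩
  have hn2 : 2 ≤ n := by
    by_contra! h
    interval_cases n <;> norm_num at hlog
  have hn0 : (0 : ℝ) < n := by exact_mod_cast (by omega : 0 < n)
  set d := (n : ℝ) * p with hd
  set l := Real.log n with hl
  have hl0 : 0 < l := by linarith
  have hd0 : 0 < d := (by positivity : 0 < c * l).trans_le hp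
  have hexp : Real.exp (-(2 * l)) = 1 / (n : ℝ) ^ 2 := by
    rw [Real.exp_neg, two_mul, Real.exp_add, hl, Real.exp_log hn0]; field_simp
  set q := ⌈2 * l⌉₊ with hq
  have hq1 : 2 * l ≤ q := Nat.le_ceil _
  have hq2 : (q : ℝ) ≤ 3 * l := (Nat.ceil_lt_add_one (by positivity)).le.trans (by linarith)
  refine (measureReal_not_isTypical_le p (by omega) (R := K * d) (θ := a / (K * d))
    (L := d * l / 256) (by positivity) (by positivity) (by positivity) q).trans ?_
  refine add_le_add ?_ ?_
  · have e1 : (n : ℝ) * Real.exp (2 * d - K * d) ≤ 1 / n := by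
      have : 2 * d - K * d ≤ -(2 * l) := by
        rw [hK]
        have : 2 * l ≤ 2 / c * d := by
          rw [div_mul_eq_mul_div, le_div_iff₀ hc]; linarith
        linarith
      refine (mul_le_mul_of_nonneg_left (Real.exp_le_exp.2 this) hn0.le).trans (le_of_eq ?_)
      rw [hexp]; field_simp
    have e2 : (n : ℝ) * (p * (Real.exp (a / (K * d) * (K * d)) - 1) / (K * d)) =
        (Real.exp a - 1) / K := by
      rw [div_mul_cancel₀ _ (by positivity)]
      have : (n : ℝ) * (p * (Real.exp a - 1) / (K * d)) = d * (Real.exp a - 1) / (K * d) := by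
        rw [hd]; ring
      rw [this]; field_simp
    have e3 : a / (K * d) * (d * l / 256) = Real.exp 1 * (3 * l) := by
      rw [ha]; field_simp; ring
    have e4 : (q.factorial : ℝ) / (Real.exp 1 * (3 * l)) ^ q ≤ 1 / (n : ℝ) ^ 2 := by
      rw [← hexp, div_le_iff₀ (by positivity), mul_pow, ← Real.exp_nat_mul, mul_one, ← mul_assoc,
        ← Real.exp_add]
      have f1 : (q.factorial : ℝ) ≤ (3 * l) ^ q :=
        (by exact_mod_cast Nat.factorial_le_pow q : (q.factorial : ℝ) ≤ (q : ℝ) ^ q).trans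
          (pow_le_pow_left₀ (by positivity) hq2 q)
      have f2 : 1 ≤ Real.exp (-(2 * l) + q) := Real.one_le_exp (by linarith)
      exact f1.trans (le_mul_of_one_le_left (by positivity) f2)
    rw [e2, e3, add_div]
    refine add_le_add e1 ?_
    refine (mul_le_mul_of_nonneg_right (mul_le_mul_of_nonneg_left e4 hn0.le)
      (Real.exp_nonneg _)).trans (le_of_eq ?_)
    rw [← hD]; field_simp
  · refine Real.exp_le_exp.2 (neg_le_neg ?_)
    have h1 := choose_two_mul_ge p.2.1 hn2
    rw [← hd] at h1
    have h2 : c ≤ d := le_trans (by nlinarith) hp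
    nlinarith

theorem WHP.mono {p : ℕ → unitInterval} {E F : ∀ n : ℕ, SimpleGraph (Fin n) → Prop}
    (h : WHP p E) (hEF : ∀ᶠ n in atTop, ∀ G, E n G → F n G) : WHP p F :=
  tendsto_of_tendsto_of_tendsto_of_le_of_le' h tendsto_const_nhds
    (hEF.mono fun _ hn => measure_mono hn) (.of_forall fun _ => prob_le_one)

theorem whp_isTypical {p : ℕ → unitInterval} {c : ℝ} (hc : 0 < c)
    (h : ∀ᶠ n : ℕ in atTop, c * Real.log n ≤ n * (p n : ℝ)) :
    WHP p fun n G => IsTypical n (p n) (n * p n * Real.log n / 256) G := by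
  obtain ⟨C, hC⟩ := measureReal_not_isTypical_le_of_log_le hc
  have hlim : Tendsto (fun n : ℕ => ENNReal.ofReal (1 - (C / n + Real.exp (-(c / 40 * n)))))
      atTop (𝓝 1) := by
    rw [← ENNReal.ofReal_one]
    refine ENNReal.tendsto_ofReal ?_
    have h1 : Tendsto (fun n : ℕ => C / (n : ℝ)) atTop (𝓝 0) := tendsto_const_div_atTop_nhds_zero_nat C
    have h2 : Tendsto (fun n : ℕ => Real.exp (-(c / 40 * n))) atTop (𝓝 0) :=
      Real.tendsto_exp_neg_atTop_nhds_zero.comp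
        (tendsto_natCast_atTop_atTop.const_mul_atTop (by positivity))
    simpa using (h1.add h2).const_sub 1
  have hlog : ∀ᶠ n : ℕ in atTop, 1 ≤ Real.log n :=
    (Real.tendsto_log_atTop.comp tendsto_natCast_atTop_atTop).eventually_ge_atTop 1
  refine tendsto_of_tendsto_of_tendsto_of_le_of_le' hlim tendsto_const_nhds ?_
    (.of_forall fun _ => prob_le_one)
  filter_upwards [h, hlog] with n hn hl
  rw [binomialRandom_apply_toGraph]
  set T := {ω : Sym2 (Fin n) → Prop |
    IsTypical n (p n) (n * p n * Real.log n / 256) (toGraph ω)}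
  have h1 : (edgeMeasure n (p n)).real Tᶜ ≤ _ := hC n hl (p n) hn
  rw [probReal_compl_eq_one_sub .of_discrete] at h1
  refine (ENNReal.ofReal_le_ofReal (by linarith : _ ≤ (edgeMeasure n (p n)).real T)).trans ?_
  rw [ofReal_measureReal]
  exact le_rfl

theorem IsTypical.certifies {p : ℝ} (hp : 0 ≤ p) {L : ℝ} {G : SimpleGraph (Fin n)}
    (h : IsTypical n p L G) : Certifies G := by
  refine certifies_of_numEdges_pos G ?_
  have : (0 : ℝ) < numEdges G := lt_of_le_of_lt (by positivity) h.1
  exact_mod_cast this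

theorem one_le_quotient {G : SimpleGraph (Fin n)} (hm : 0 < numEdges G) : 1 ≤ quotient G := by
  rw [quotient_eq G hm, le_add_iff_nonneg_right]
  exact div_nonneg (chi_nonneg G) (by positivity)

theorem IsTypical.quotient_le {p : ℝ} (hp0 : 0 ≤ p) (hp1 : p ≤ 1) (hn : 2 ≤ n)
    (hd : 64 ≤ n * p * Real.log n) {G : SimpleGraph (Fin n)}
    (h : IsTypical n p (n * p * Real.log n / 256) G) :
    quotient G ≤ 1 + √(Real.log n / (n * p)) := by
  rw [quotient_eq G (h.certifies hp0).1, add_le_add_iff_left, chi]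
  obtain ⟨hm, hl⟩ := h
  have h1 := choose_two_mul_ge hp0 hn
  set d := (n : ℝ) * p
  set l := Real.log n
  have hn0 : (0 : ℝ) < n := by exact_mod_cast (by omega : 0 < n)
  have hd0 : 0 < d := lt_of_le_of_ne (by positivity) fun h0 => by rw [← h0] at hd; norm_num at hd
  have hs : √(d * l / 256) = √(d * l) / 16 := by
    rw [Real.sqrt_div (by linarith), show (256 : ℝ) = 16 ^ 2 by norm_num, Real.sqrt_sq (by norm_num)]
  have hs8 : 8 ≤ √(d * l) := Real.le_sqrt_of_sq_le (by linarith)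
  have hsd : √(l / d) = √(d * l) / d := by
    rw [show l / d = d * l / d ^ 2 by field_simp, Real.sqrt_div (by linarith), Real.sqrt_sq hd0.le]
  rw [hs] at hl
  rw [hsd, div_le_div_iff₀ (by linarith [mul_pos hn0 hd0]) hd0]
  -- The term `p ≤ 1` is absorbed by `√(d l) / 8 ≥ 1`, which is where `64 ≤ d l` is needed.
  have h2 : -minEigenvalue G ≤ √(d * l) / 4 := by linarith
  have h3 : n * d / 4 ≤ 2 * numEdges G := by linarith
  calc -(n * minEigenvalue G) * d = (n * d) * (-minEigenvalue G) := by ring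
    _ ≤ (n * d) * (√(d * l) / 4) := mul_le_mul_of_nonneg_left h2 (by positivity)
    _ = √(d * l) * (n * d / 4) := by ring
    _ ≤ _ := mul_le_mul_of_nonneg_left h3 (Real.sqrt_nonneg _)

theorem eventually_le_log (C : ℝ) : ∀ᶠ n : ℕ in atTop, C ≤ Real.log n :=
  (Real.tendsto_log_atTop.comp tendsto_natCast_atTop_atTop).eventually_ge_atTop C

/-- Above the connectivity scale `log n / n`, the quotient is certified and at most
`1 + √(log n / (n p))` with high probability. -/
theorem whp_certifies_and_quotient_le {p : ℕ → unitInterval} {c : ℝ} (hc : 0 < c)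
    (h : ∀ᶠ n : ℕ in atTop, c * Real.log n ≤ n * (p n : ℝ)) :
    WHP p fun n G => Certifies G ∧ 1 ≤ quotient G ∧
      quotient G ≤ 1 + √(Real.log n / (n * (p n : ℝ))) := by
  refine (whp_isTypical hc h).mono ?_
  filter_upwards [h, eventually_le_log 1, eventually_le_log (64 / c), eventually_ge_atTop 2]
    with n hn hl1 hl2 hn2 G hG
  refine ⟨hG.certifies (p n).2.1, one_le_quotient (hG.certifies (p n).2.1).1,
    hG.quotient_le (p n).2.1 (p n).2.2 hn2 ?_⟩
  rw [div_le_iff₀ hc] at hl2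
  nlinarith

theorem eventually_mul_log_le_of_isBigO {p : ℕ → unitInterval}
    (h : (fun n : ℕ => √(Real.log n / n)) =O[atTop] fun n : ℕ => (p n : ℝ)) {K : ℝ} (hK : 0 < K) :
    ∀ᶠ n : ℕ in atTop, K * Real.log n ≤ n * (p n : ℝ) := by
  obtain ⟨C, hC, hb⟩ := h.exists_pos
  have hlo := (Real.isLittleO_log_id_atTop.comp_tendsto tendsto_natCast_atTop_atTop).bound
    (show 0 < 1 / (K * C) ^ 2 by positivity)
  filter_upwards [hb.bound, hlo, eventually_le_log 1, eventually_ge_atTop 1] with n h1 h2 h3 h4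
  have hn0 : (0 : ℝ) < n := by exact_mod_cast h4
  simp only [Function.comp, id, Real.norm_eq_abs, abs_of_pos hn0,
    abs_of_nonneg (zero_le_one.trans h3)] at h2
  rw [Real.norm_of_nonneg (Real.sqrt_nonneg _), Real.norm_of_nonneg (p n).2.1] at h1
  -- Equivalent to `(K C) ^ 2 log n ≤ n`, which holds eventually.
  have h5 : K * C * Real.log n / n ≤ √(Real.log n / n) := by
    refine Real.le_sqrt_of_sq_le ?_
    rw [div_pow, div_le_div_iff₀ (by positivity) hn0]
    rw [div_mul_eq_mul_div, one_mul, le_div_iff₀ (by positivity)] at h2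
    have : 0 ≤ Real.log n * n := by positivity
    nlinarith
  have h6 := h5.trans h1
  rw [div_le_iff₀ hn0] at h6
  exact le_of_mul_le_mul_left (by linarith) hC

theorem eventually_sqrt_le_of_isBigO {p : ℕ → unitInterval}
    (h : (fun n : ℕ => √(Real.log n / n)) =O[atTop] fun n : ℕ => (p n : ℝ)) :
    ∀ᶠ n : ℕ in atTop, √(n : ℝ) ≤ n * (p n : ℝ) := by
  obtain ⟨C, hC, hb⟩ := h.exists_pos
  filter_upwards [hb.bound, eventually_le_log (C ^ 2), eventually_ge_atTop 1] with n h1 h2 h4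
  have hn0 : (0 : ℝ) < n := by exact_mod_cast h4
  rw [Real.norm_of_nonneg (Real.sqrt_nonneg _), Real.norm_of_nonneg (p n).2.1] at h1
  -- Equivalent to `C ^ 2 ≤ log n`.
  have h5 : C * √n / n ≤ √(Real.log n / n) := by
    refine Real.le_sqrt_of_sq_le ?_
    rw [div_pow, mul_pow, Real.sq_sqrt hn0.le, div_le_div_iff₀ (by positivity) hn0]
    nlinarith [sq_nonneg (n : ℝ)]
  have h6 := h5.trans h1
  rw [div_le_iff₀ hn0] at h6
  exact le_of_mul_le_mul_left (by linarith) hC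

end HighProbability

end MaxCutSpectral

theorem mainTheorem7 (p : ℕ → unitInterval) :
    -- the general bound
    (∀ g : ℕ → ℝ, Monotone g → (∀ᶠ n in Filter.atTop, 0 < g n) →
      (∀ᶠ n : ℕ in Filter.atTop, g n / 2 * Real.log n ≤ n * (p n : ℝ)) →
      MaxCutSpectral.WHP p fun n G =>
        MaxCutSpectral.Certifies G ∧ MaxCutSpectral.quotient G ≤ 1 + √(2 / g n)) ∧
    -- dense graphs
    ((fun n : ℕ => √(Real.log n / n)) =O[Filter.atTop] (fun n : ℕ => (p n : ℝ)) →
      (∃ g : ℕ → ℝ, Monotone g ∧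
        ∀ᶠ n : ℕ in Filter.atTop, g n ≤ n * (p n : ℝ) ∧ √(n : ℝ) ≤ g n) ∧
      ∀ ε : ℝ, 0 < ε → MaxCutSpectral.WHP p fun _ G =>
        MaxCutSpectral.Certifies G ∧ |MaxCutSpectral.quotient G - 1| ≤ ε) ∧
    -- sparse graphs
    (∀ c : ℝ, 0 < c → (∀ᶠ n : ℕ in Filter.atTop, n * (p n : ℝ) = c * Real.log n) →
      MaxCutSpectral.WHP p fun _ G =>
        MaxCutSpectral.Certifies G ∧ MaxCutSpectral.quotient G ≤ 1 + √(2 / c)) := by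
  refine ⟨fun g hg hpos hle => ?_, fun hO => ⟨⟨fun n => √(n : ℝ), fun a b hab =>
    Real.sqrt_le_sqrt (by exact_mod_cast hab),
    (MaxCutSpectral.eventually_sqrt_le_of_isBigO hO).mono fun n hn => ⟨hn, le_rfl⟩⟩,
    fun ε hε => ?_⟩, fun c hc heq => ?_⟩
  · obtain ⟨N, hN⟩ := Filter.eventually_atTop.1 hpos
    -- Monotonicity of `g` supplies a constant `c = g N / 2` for the uniform estimate; the varying
    -- `g n` returns only in the final comparison of square roots.
    have hc : 0 < g N / 2 := half_pos (hN N le_rfl)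
    have hlow : ∀ᶠ n : ℕ in Filter.atTop, g N / 2 * Real.log n ≤ n * (p n : ℝ) := by
      filter_upwards [hle, Filter.eventually_ge_atTop N, MaxCutSpectral.eventually_le_log 0]
        with n hn hnN hl
      refine le_trans (mul_le_mul_of_nonneg_right ?_ hl) hn
      linarith [hg hnN]
    refine (MaxCutSpectral.whp_certifies_and_quotient_le hc hlow).mono ?_
    filter_upwards [hle, hpos, MaxCutSpectral.eventually_le_log 1] with n hn hgn hl G hG
    refine ⟨hG.1, hG.2.2.trans (add_le_add le_rfl (Real.sqrt_le_sqrt ?_))⟩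
    have : 0 < g n / 2 * Real.log n := by positivity
    rw [div_le_div_iff₀ (this.trans_le hn) hgn]
    linarith
  · refine (MaxCutSpectral.whp_certifies_and_quotient_le one_pos
      (MaxCutSpectral.eventually_mul_log_le_of_isBigO hO one_pos)).mono ?_
    -- The factor `1 / ε ^ 2` is what makes `√(log n / (np)) ≤ ε`.
    filter_upwards [MaxCutSpectral.eventually_mul_log_le_of_isBigO hO (K := 1 / ε ^ 2)
      (by positivity), MaxCutSpectral.eventually_le_log 1] with n hn hl G hG
    refine ⟨hG.1, ?_⟩
    rw [abs_of_nonneg (sub_nonneg.2 hG.2.1), sub_le_iff_le_add']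
    refine hG.2.2.trans (add_le_add le_rfl (Real.sqrt_le_iff.2 ⟨hε.le, ?_⟩))
    have : 0 < 1 / ε ^ 2 * Real.log n := by positivity
    rw [div_le_iff₀ (this.trans_le hn)]
    rwa [div_mul_eq_mul_div, one_mul, div_le_iff₀ (by positivity), mul_comm] at hn
  · refine (MaxCutSpectral.whp_certifies_and_quotient_le hc (heq.mono fun n hn => hn.ge)).mono ?_
    filter_upwards [heq, MaxCutSpectral.eventually_le_log 1] with n hn hl G hG
    refine ⟨hG.1, hG.2.2.trans (add_le_add le_rfl (Real.sqrt_le_sqrt ?_))⟩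
    have : 0 < c * Real.log n := by positivity
    rw [hn, div_le_div_iff₀ this hc]
    linarith
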